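/- Let $X, X_1, X_2, \dots$ be i.i.d. real random variables with $P(X<0)>0$ and $P(X\le 0)<1$. Put $S_0=0$, $S_n=X_1+\dots+X_n$, and let $R_n=\max_{0\le j\le n}S_j-S_n$, $n=0,1,2,\dots$, be the random walk reflected in its maximum. (a) $\liminf_{n\to\infty}P(R_n>x)>0$ for every $x>0$; consequently $\limsup_{n\to\infty}R_n=+\infty$ almost surely, and $R_n$ does not converge to $0$ in probability as $n\to\infty$. (b) (i) $R_n\to\infty$ in probability as $n\to\infty$ (that is, $P(R_n>x)\to1$ for every real $x$) if and only if $\liminf_{n\to\infty}S_n=-\infty$ almost surely. (ii) The following conditions are equivalent: $P(R_n=0\text{ for infinitely many }n)<1$; $\lim_{n\to\infty}S_n=-\infty$ almost surely; $\lim_{n\to\infty}R_n=+\infty$ almost surely; $\sum_{n\ge1}P(R_n\le x)<\infty$ for some $x\ge0$; $\sum_{n\ge1}P(R_n\le x)<\infty$ for every $x\ge0$. -/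

import Mathlib

open Filter Topology MeasureTheory ProbabilityTheory

noncomputable section

/-- The random walk `S n = X₁ + ⋯ + Xₙ`, `S 0 = 0`. Steps are numbered from zero:
the function `X i` is the step number `i + 1`. -/
def randomWalk {Ω : Type*} (X : ℕ → Ω → ℝ) (n : ℕ) (ω : Ω) : ℝ :=
  ∑ i ∈ Finset.range n, X i ω

/-- The running maximum `max (S 0, …, S n)` of the random walk. -/
def walkMax {Ω : Type*} (X : ℕ → Ω → ℝ) (n : ℕ) (ω : Ω) : ℝ :=
  (Finset.range (n + 1)).sup' Finset.nonempty_range_add_one (fun j => randomWalk X j ω)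

/-- The random walk reflected in its maximum, `R n = max (S 0, …, S n) - S n`. -/
def reflectedWalk {Ω : Type*} (X : ℕ → Ω → ℝ) (n : ℕ) (ω : Ω) : ℝ :=
  walkMax X n ω - randomWalk X n ω

/-- Convergence in probability to `+∞`: for every real `x`, `P (Y n > x) → 1`. -/
def TendstoInProbabilityAtTop {Ω : Type*} [MeasurableSpace Ω] (P : Measure Ω)
    (Y : ℕ → Ω → ℝ) : Prop :=
  ∀ x : ℝ, Tendsto (fun n => P {ω | x < Y n ω}) atTop (𝓝 1)

end

/-! A run of `k` steps below `-ε` pushes `R` to at least `k * ε`. Its probability is positive and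
independent of where it starts, which gives the bound in (a); runs over disjoint blocks are
independent, so the second Borel–Cantelli lemma gives the limsup.

For (b)(i), reversing the first `n` steps turns `R n` into `-min (S 0, …, S n)` in law. Those minima
decrease in `n`, so `P (R n > x)` converges to the probability that the walk ever goes below `-x`.

The core of (b)(ii) is a last-exit decomposition (`measure_last_zero_eq`). After the last zero of
`R` the walk stays strictly below its maximum, so `n` is the last zero with probability `P (R n = 0)
* v`, where `v` is the probability that the walk stays negative after time 0. These events are
disjoint; if zeros may stop, `v > 0` and `∑ P (R n = 0)` is finite. A run of upward steps carries
`R` from below `x` to zero, so `∑ P (R n ≤ x)` is finite too, and Borel–Cantelli gives `R → ∞`. The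
maximum is then eventually constant, whence `S → -∞`; conversely `R n ≥ -S n`. -/

/-! ### The path of the reflected walk -/

section Path

variable {Ω : Type*} {X : ℕ → Ω → ℝ} {ω : Ω}

theorem randomWalk_succ (n : ℕ) :
    randomWalk X (n + 1) ω = randomWalk X n ω + X n ω :=
  Finset.sum_range_succ _ _

theorem randomWalk_le_walkMax {j n : ℕ} (h : j ≤ n) : randomWalk X j ω ≤ walkMax X n ω :=
  Finset.le_sup' (fun j => randomWalk X j ω) (Finset.mem_range.2 (Nat.lt_succ_of_le h))

theorem walkMax_le_iff {n : ℕ} {a : ℝ} :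
    walkMax X n ω ≤ a ↔ ∀ j ≤ n, randomWalk X j ω ≤ a := by
  simp [walkMax, Finset.sup'_le_iff]

theorem walkMax_succ (n : ℕ) :
    walkMax X (n + 1) ω = max (walkMax X n ω) (randomWalk X (n + 1) ω) := by
  refine le_antisymm (walkMax_le_iff.2 fun j hj => ?_)
    (max_le (walkMax_le_iff.2 fun j hj => randomWalk_le_walkMax (by omega))
      (randomWalk_le_walkMax le_rfl))
  rcases Nat.le_succ_iff.1 hj with h | h
  · exact (randomWalk_le_walkMax h).trans (le_max_left _ _)
  · exact h ▸ le_max_right _ _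

theorem reflectedWalk_zero : reflectedWalk X 0 ω = 0 := by
  simp [reflectedWalk, walkMax]

theorem reflectedWalk_succ (n : ℕ) :
    reflectedWalk X (n + 1) ω = max (reflectedWalk X n ω - X n ω) 0 := by
  rw [reflectedWalk, walkMax_succ, ← max_sub_sub_right, sub_self, randomWalk_succ,
    reflectedWalk, sub_sub]

theorem reflectedWalk_nonneg (n : ℕ) : 0 ≤ reflectedWalk X n ω :=
  sub_nonneg.2 (randomWalk_le_walkMax le_rfl)

theorem sub_le_reflectedWalk {j n : ℕ} (h : j ≤ n) :
    randomWalk X j ω - randomWalk X n ω ≤ reflectedWalk X n ω :=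
  sub_le_sub_right (randomWalk_le_walkMax h) _

theorem lt_reflectedWalk_iff {n : ℕ} {x : ℝ} :
    x < reflectedWalk X n ω ↔ ∃ j ≤ n, x < randomWalk X j ω - randomWalk X n ω := by
  rw [← not_le, reflectedWalk, sub_le_iff_le_add, walkMax_le_iff]
  simp only [not_forall, not_le, exists_prop, lt_sub_iff_add_lt]

/-- The running maximum stays constant as long as the reflected walk avoids zero. -/
theorem walkMax_eq_of_reflectedWalk_ne_zero {n : ℕ}
    (h : ∀ m, n < m → reflectedWalk X m ω ≠ 0) {m : ℕ} (hm : n ≤ m) :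
    walkMax X m ω = walkMax X n ω := by
  induction m, hm using Nat.le_induction with
  | base => rfl
  | succ m hm ih =>
    rcases max_choice (walkMax X m ω) (randomWalk X (m + 1) ω) with h' | h'
    · rw [walkMax_succ, h', ih]
    · exact absurd (by rw [reflectedWalk, walkMax_succ, h', sub_self]) (h (m + 1) (by omega))

theorem nsmul_le_sub_of_forall_lt {n k : ℕ} {ε : ℝ} (h : ∀ i < k, X (n + i) ω < -ε) :
    k * ε ≤ randomWalk X n ω - randomWalk X (n + k) ω := by
  induction k with
  | zero => simp
  | succ k ih =>
    have h1 := ih fun i hi => h i (by omega)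
    have h2 := h k (by omega)
    rw [← add_assoc, randomWalk_succ]
    push_cast
    linarith

theorem reflectedWalk_add_le {n k : ℕ} {δ : ℝ} (hδ : 0 ≤ δ)
    (h : ∀ i < k, δ < X (n + i) ω) :
    reflectedWalk X (n + k) ω ≤ max (reflectedWalk X n ω - k * δ) 0 := by
  induction k with
  | zero => simp
  | succ k ih =>
    have h1 := ih fun i hi => h i (by omega)
    have h2 := h k (by omega)
    rw [← add_assoc, reflectedWalk_succ]
    push_cast
    refine max_le ?_ (le_max_right _ _)
    rcases le_total (reflectedWalk X n ω - k * δ) 0 with h3 | h3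
    · rw [max_eq_right h3] at h1
      exact le_max_of_le_right (by linarith)
    · rw [max_eq_left h3] at h1
      refine le_max_of_le_left ?_
      linarith

/-- If the reflected walk tends to infinity, the running maximum is eventually constant, so that
the walk drifts to `-∞`. -/
theorem tendsto_randomWalk_atBot_of_reflectedWalk
    (h : Tendsto (fun n => reflectedWalk X n ω) atTop atTop) :
    Tendsto (fun n => randomWalk X n ω) atTop atBot := by
  obtain ⟨n, hn⟩ := eventually_atTop.1 (h.eventually_gt_atTop 0)
  have hM : ∀ m ≥ n, walkMax X n ω - reflectedWalk X m ω = randomWalk X m ω := fun m hm => by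
    rw [← walkMax_eq_of_reflectedWalk_ne_zero (fun m hm => (hn m hm.le).ne') hm, reflectedWalk,
      sub_sub_cancel]
  refine Tendsto.congr' (eventually_atTop.2 ⟨n, hM⟩) ?_
  simp only [sub_eq_add_neg]
  exact tendsto_atBot_add_const_left atTop (walkMax X n ω) (tendsto_neg_atTop_atBot.comp h)

theorem tendsto_reflectedWalk_atTop_of_randomWalk
    (h : Tendsto (fun n => randomWalk X n ω) atTop atBot) :
    Tendsto (fun n => reflectedWalk X n ω) atTop atTop := by
  refine tendsto_atTop_mono (fun n => ?_) (tendsto_neg_atBot_atTop.comp h)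
  simpa [randomWalk] using sub_le_reflectedWalk (X := X) (ω := ω) (Nat.zero_le n)

/-- At the last zero of the reflected walk the walk attains its maximum for the last time. -/
theorem exists_last_zero (h : ¬ ∃ᶠ n in atTop, reflectedWalk X n ω = 0) :
    ∃ n, reflectedWalk X n ω = 0 ∧ ∀ m, 0 < m → randomWalk X (n + m) ω < randomWalk X n ω := by
  rw [Nat.frequently_atTop_iff_infinite, Set.not_infinite] at h
  obtain ⟨n, hn, hmax⟩ := h.exists_maximal ⟨0, reflectedWalk_zero⟩
  have hne : ∀ m, n < m → reflectedWalk X m ω ≠ 0 := fun m hm h0 =>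
    absurd (hmax h0 hm.le) (not_le.2 hm)
  refine ⟨n, hn, fun m hm => ?_⟩
  have h1 := walkMax_eq_of_reflectedWalk_ne_zero hne (Nat.le_add_right n m)
  have h2 := (reflectedWalk_nonneg (X := X) (ω := ω) (n + m)).lt_of_ne (hne _ (by omega)).symm
  have h3 : reflectedWalk X n ω = 0 := hn
  rw [reflectedWalk] at h2 h3
  linarith

theorem liminf_randomWalk_eq_bot_iff :
    liminf (fun n => (randomWalk X n ω : EReal)) atTop = ⊥ ↔
      ∀ x : ℝ, ∃ j, randomWalk X j ω < x := by
  constructor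
  · intro h x
    have : ∃ᶠ n in atTop, (randomWalk X n ω : EReal) < (x : EReal) :=
      frequently_lt_of_liminf_lt (by isBoundedDefault) (h ▸ EReal.bot_lt_coe x)
    obtain ⟨n, hn⟩ := this.exists
    exact ⟨n, EReal.coe_lt_coe_iff.1 hn⟩
  · intro h
    refine (EReal.eq_bot_iff_forall_lt _).2 fun x => ?_
    have : ∃ᶠ n in atTop, (randomWalk X n ω : EReal) ≤ ((x - 1 : ℝ) : EReal) := by
      refine frequently_atTop.2 fun N => ?_
      obtain ⟨i, -, hi⟩ := (Finset.range (N + 1)).exists_min_image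
        (fun n => randomWalk X n ω) Finset.nonempty_range_add_one
      -- A value below the minimum over times `0, …, N` can only occur after time `N`.
      obtain ⟨j, hj⟩ := h (min (randomWalk X i ω) (x - 1))
      refine ⟨j, ?_, EReal.coe_le_coe_iff.2 (hj.trans_le (min_le_right _ _)).le⟩
      by_contra hjN
      exact absurd (hj.trans_le (min_le_left _ _))
        (not_lt.2 (hi j (Finset.mem_range.2 (by omega))))
    exact (liminf_le_of_frequently_le this (by isBoundedDefault)).trans_lt
      (EReal.coe_lt_coe_iff.2 (by linarith))

/-- Links the `Finset` form used for independence with the offset form used for paths. -/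
theorem mem_block_iff {n k : ℕ} {A : Set ℝ} :
    (∀ i ∈ Finset.Ico n (n + k), X i ω ∈ A) ↔ ∀ i < k, X (n + i) ω ∈ A := by
  refine ⟨fun h i hi => h _ (Finset.mem_Ico.2 (by omega)), fun h i hi => ?_⟩
  rw [Finset.mem_Ico] at hi
  simpa [Nat.add_sub_cancel' hi.1] using h (i - n) (by omega)

end Path

/-! ### Measurability and independence -/

section Law

variable {Ω : Type*}

theorem measurable_randomWalk [MeasurableSpace Ω] {X : ℕ → Ω → ℝ} {n : ℕ}
    (h : ∀ i < n, Measurable (X i)) : Measurable (randomWalk X n) :=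
  Finset.measurable_fun_sum _ fun i hi => h i (Finset.mem_range.1 hi)

theorem measurableSet_forall_randomWalk_neg [MeasurableSpace Ω] {X : ℕ → Ω → ℝ}
    (h : ∀ i, Measurable (X i)) :
    MeasurableSet {ω | ∀ m, 0 < m → randomWalk X m ω < 0} := by
  simp only [Set.ofPred_forall]
  exact MeasurableSet.iInter fun m => MeasurableSet.iInter fun _ =>
    measurableSet_lt (measurable_randomWalk fun i _ => h i) measurable_const

/-- Only the first `n` steps are assumed measurable, so that the σ-algebra may be the one they
generate, as `measure_inter_past_future` needs. -/
theorem measurable_reflectedWalk [MeasurableSpace Ω] {X : ℕ → Ω → ℝ} {n : ℕ}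
    (h : ∀ i < n, Measurable (X i)) : Measurable (reflectedWalk X n) := by
  refine Measurable.sub ?_ (measurable_randomWalk h)
  have : walkMax X n = (Finset.range (n + 1)).sup' Finset.nonempty_range_add_one
      (fun j => randomWalk X j) := by
    ext ω
    simp [walkMax, Finset.sup'_apply]
  rw [this]
  exact Finset.measurable_sup' _ fun j hj => measurable_randomWalk fun i hi =>
    h i (by have := Finset.mem_range.1 hj; omega)

theorem measurableSet_forall_mem_finset [MeasurableSpace Ω] {X : ℕ → Ω → ℝ} {s : Finset ℕ}
    (h : ∀ i ∈ s, Measurable (X i)) {A : Set ℝ} (hA : MeasurableSet A) :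
    MeasurableSet {ω | ∀ i ∈ s, X i ω ∈ A} := by
  have : {ω | ∀ i ∈ s, X i ω ∈ A} = ⋂ i ∈ s, X i ⁻¹' A := by ext; simp
  rw [this]
  exact Finset.measurableSet_biInter _ fun i hi => h i hi hA

variable [MeasurableSpace Ω] {P : Measure Ω} {X : ℕ → Ω → ℝ}

/-- Relabelling the steps of an i.i.d. sequence injectively does not change its law. -/
theorem measure_comp_injective [IsProbabilityMeasure P] (hmeas : ∀ i, Measurable (X i))
    (hindep : iIndepFun X P) (hident : ∀ i, IdentDistrib (X i) (X 0) P P)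
    {σ : ℕ → ℕ} (hσ : σ.Injective) {B : Set (ℕ → ℝ)} (hB : MeasurableSet B) :
    P {ω | (fun i => X (σ i) ω) ∈ B} = P {ω | (fun i => X i ω) ∈ B} := by
  have key : P.map (fun ω i => X (σ i) ω) = P.map (fun ω i => X i ω) := by
    rw [(hindep.precomp hσ).map_fun_eq_infinitePi_map fun i => hmeas _,
      hindep.map_fun_eq_infinitePi_map hmeas]
    congr 1
    ext1 i
    rw [(hident (σ i)).map_eq, (hident i).map_eq]
  have := congrArg (fun μ => μ B) key
  rwa [Measure.map_apply (measurable_pi_lambda _ fun i => hmeas _) hB,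
    Measure.map_apply (measurable_pi_lambda _ hmeas) hB] at this

/-- An event determined by the first `n` steps is independent of an event determined by the
later steps. -/
theorem measure_inter_past_future (hmeas : ∀ i, Measurable (X i)) (hindep : iIndepFun X P)
    {n : ℕ} {A B : Set Ω}
    (hA : ∀ m : MeasurableSpace Ω, (∀ i < n, Measurable[m] (X i)) → MeasurableSet[m] A)
    (hB : ∀ m : MeasurableSpace Ω, (∀ i, n ≤ i → Measurable[m] (X i)) → MeasurableSet[m] B) :
    P (A ∩ B) = P A * P B := by
  have hdisj : Disjoint (Set.Iio n) (Set.Ici n) :=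
    Set.disjoint_left.2 fun i hi hi' => absurd (Set.mem_Iio.1 hi) (not_lt.2 (Set.mem_Ici.1 hi'))
  have := indep_iSup_of_disjoint (fun i => (hmeas i).comap_le)
    ((iIndepFun_iff_iIndep _ _ _).1 hindep) hdisj
  refine (Indep_iff _ _ _).1 this A B (hA _ fun i hi => ?_) (hB _ fun i hi => ?_)
  · exact Measurable.of_comap_le (le_iSup₂_of_le i hi le_rfl)
  · exact Measurable.of_comap_le (le_iSup₂_of_le i hi le_rfl)

theorem measure_forall_mem_finset (hindep : iIndepFun X P)
    (hident : ∀ i, IdentDistrib (X i) (X 0) P P) {A : Set ℝ} (hA : MeasurableSet A)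
    (s : Finset ℕ) : P {ω | ∀ i ∈ s, X i ω ∈ A} = P {ω | X 0 ω ∈ A} ^ s.card := by
  have h := hindep.measure_inter_preimage_eq_mul s (sets := fun _ => A) fun _ _ => hA
  have h' : ∀ i ∈ s, P (X i ⁻¹' A) = P {ω | X 0 ω ∈ A} := fun i _ =>
    (hident i).measure_mem_eq hA
  rw [Finset.prod_congr rfl h', Finset.prod_const] at h
  rw [← h]
  congr 1
  ext ω
  simp

end Law

/-! ### Probability estimates -/

section IID

variable {Ω : Type*} [MeasurableSpace Ω] {P : Measure Ω} {X : ℕ → Ω → ℝ}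

theorem exists_pos_measure_lt_neg {Y : Ω → ℝ} (h : 0 < P {ω | Y ω < 0}) :
    ∃ ε : ℝ, 0 < ε ∧ 0 < P {ω | Y ω < -ε} := by
  have hU : {ω | Y ω < 0} ⊆ ⋃ n : ℕ, {ω | Y ω < -(1 / ((n : ℝ) + 1))} := fun ω hω => by
    obtain ⟨n, hn⟩ := exists_nat_one_div_lt (neg_pos.2 (show Y ω < 0 from hω))
    exact Set.mem_iUnion.2 ⟨n, by simp only [Set.mem_ofPred_eq]; linarith⟩
  obtain ⟨n, hn⟩ := exists_measure_pos_of_not_measure_iUnion_null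
    (h.trans_le (measure_mono hU)).ne'
  exact ⟨_, Nat.one_div_pos_of_nat, hn⟩

theorem pow_le_measure_lt_reflectedWalk (hindep : iIndepFun X P)
    (hident : ∀ i, IdentDistrib (X i) (X 0) P P) {ε x : ℝ} {k : ℕ} (hk : x < k * ε) (n : ℕ) :
    P {ω | X 0 ω < -ε} ^ k ≤ P {ω | x < reflectedWalk X (n + k) ω} := by
  have h := measure_forall_mem_finset hindep hident (measurableSet_Iio (a := -ε))
    (Finset.Ico n (n + k))
  rw [Nat.card_Ico, Nat.add_sub_cancel_left] at h
  simp only [mem_block_iff] at h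
  refine h.symm.le.trans (measure_mono fun ω hω => ?_)
  exact hk.trans_le ((nsmul_le_sub_of_forall_lt hω).trans (sub_le_reflectedWalk (by omega)))

/-- The blocks are disjoint, hence independent, and all have the same positive probability: second
Borel–Cantelli. -/
theorem ae_frequently_forall_block (hmeas : ∀ i, Measurable (X i)) (hindep : iIndepFun X P)
    (hident : ∀ i, IdentDistrib (X i) (X 0) P P) {A : Set ℝ} (hA : MeasurableSet A)
    (hpos : P {ω | X 0 ω ∈ A} ≠ 0) (k : ℕ) :
    ∀ᵐ ω ∂P, ∃ᶠ j in atTop, ∀ i < k, X (j * k + i) ω ∈ A := by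
  have := hindep.isProbabilityMeasure
  set s : ℕ → Set Ω := fun j => {ω | ∀ i ∈ Finset.Ico (j * k) (j * k + k), X i ω ∈ A} with hs
  have hsm : ∀ j, MeasurableSet (s j) := fun j =>
    measurableSet_forall_mem_finset (fun i _ => hmeas i) hA
  have hsP : ∀ j, P (s j) = P {ω | X 0 ω ∈ A} ^ k := fun j => by
    rw [hs, measure_forall_mem_finset hindep hident hA, Nat.card_Ico, Nat.add_sub_cancel_left]
  have hdisj : Pairwise fun i j =>
      Disjoint (Finset.Ico (i * k) (i * k + k)) (Finset.Ico (j * k) (j * k + k)) := by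
    intro i j hij
    wlog h : i < j generalizing i j
    · exact (this hij.symm (by omega)).symm
    refine Finset.disjoint_left.2 fun a ha ha' => ?_
    rw [Finset.mem_Ico] at ha ha'
    have := Nat.mul_le_mul_right k (Nat.succ_le_of_lt h)
    rw [Nat.succ_mul] at this
    omega
  have hsi : iIndepSet s P := by
    refine (iIndepSet_iff_meas_biInter hsm).2 fun t => ?_
    have hst : ⋂ j ∈ t, s j =
        {ω | ∀ i ∈ t.biUnion fun j => Finset.Ico (j * k) (j * k + k), X i ω ∈ A} := by
      ext ω
      simp only [hs, Set.mem_iInter, Set.mem_ofPred_eq, Finset.mem_biUnion]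
      exact ⟨fun h i ⟨j, hj, hi⟩ => h j hj i hi, fun h j hj i hi => h i ⟨j, hj, hi⟩⟩
    rw [hst, measure_forall_mem_finset hindep hident hA,
      Finset.card_biUnion fun i _ j _ hij => hdisj hij, Finset.prod_congr rfl fun j _ => hsP j]
    simp [pow_mul, mul_comm]
  have h1 := measure_limsup_eq_one hsm hsi (by
    simp only [hsP]
    exact ENNReal.tsum_const_eq_top_of_ne_zero (pow_ne_zero _ hpos))
  filter_upwards [(mem_ae_iff_prob_eq_one (MeasurableSet.measurableSet_limsup hsm)).2 h1]
    with ω hω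
  exact (mem_limsup_iff_frequently_mem.1 hω).mono fun j hj => mem_block_iff.1 hj

theorem ae_limsup_reflectedWalk_eq_top (hmeas : ∀ i, Measurable (X i)) (hindep : iIndepFun X P)
    (hident : ∀ i, IdentDistrib (X i) (X 0) P P) (hneg : 0 < P {ω | X 0 ω < 0}) :
    ∀ᵐ ω ∂P, limsup (fun n => (reflectedWalk X n ω : EReal)) atTop = ⊤ := by
  obtain ⟨ε, hε, hP⟩ := exists_pos_measure_lt_neg hneg
  have h : ∀ᵐ ω ∂P, ∀ k : ℕ, ∃ᶠ j in atTop, ∀ i < k, X (j * k + i) ω ∈ Set.Iio (-ε) :=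
    ae_all_iff.2 fun k => ae_frequently_forall_block hmeas hindep hident measurableSet_Iio hP.ne' k
  filter_upwards [h] with ω hω
  refine (EReal.eq_top_iff_forall_lt _).2 fun x => ?_
  -- The `0` makes `k` positive, so that block ends go to infinity; `x + 1` makes the final
  -- inequality strict.
  obtain ⟨k, hk⟩ := exists_nat_gt (max 0 ((x + 1) / ε))
  have hk0 : 0 < k := Nat.cast_pos.1 ((le_max_left _ _).trans_lt hk)
  have hkx : x + 1 < k * ε := (div_lt_iff₀ hε).1 ((le_max_right _ _).trans_lt hk)
  have hf : ∃ᶠ n in atTop, ((x + 1 : ℝ) : EReal) ≤ (reflectedWalk X n ω : EReal) := by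
    refine frequently_atTop.2 fun N => ?_
    obtain ⟨j, hjN, hj⟩ := frequently_atTop.1 (hω k) N
    refine ⟨j * k + k, by nlinarith, EReal.coe_le_coe_iff.2 ?_⟩
    exact hkx.le.trans ((nsmul_le_sub_of_forall_lt hj).trans (sub_le_reflectedWalk (by omega)))
  exact (EReal.coe_lt_coe_iff.2 (lt_add_one x)).trans_le
    (le_limsup_of_frequently_le hf (by isBoundedDefault))

theorem liminf_measure_lt_reflectedWalk_pos (hindep : iIndepFun X P)
    (hident : ∀ i, IdentDistrib (X i) (X 0) P P) (hneg : 0 < P {ω | X 0 ω < 0}) (x : ℝ) :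
    0 < liminf (fun n => P {ω | x < reflectedWalk X n ω}) atTop := by
  obtain ⟨ε, hε, hP⟩ := exists_pos_measure_lt_neg hneg
  obtain ⟨k, hk⟩ := exists_nat_gt (x / ε)
  refine (ENNReal.pow_pos hP k).trans_le (le_liminf_of_le (by isBoundedDefault) ?_)
  refine eventually_atTop.2 ⟨k, fun n hn => ?_⟩
  have := pow_le_measure_lt_reflectedWalk hindep hident ((div_lt_iff₀ hε).1 hk) (n - k)
  rwa [Nat.sub_add_cancel hn] at this

theorem not_tendstoInMeasure_reflectedWalk (hindep : iIndepFun X P)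
    (hident : ∀ i, IdentDistrib (X i) (X 0) P P) (hneg : 0 < P {ω | X 0 ω < 0}) :
    ¬ TendstoInMeasure P (reflectedWalk X) atTop (fun _ => (0 : ℝ)) := by
  intro h
  have h0 := h 1 one_pos
  refine (liminf_measure_lt_reflectedWalk_pos hindep hident hneg 1).ne' ?_
  refine le_antisymm ?_ zero_le
  rw [← h0.liminf_eq]
  refine liminf_le_liminf (Eventually.of_forall fun n => measure_mono fun ω hω => ?_)
  rw [Set.mem_ofPred_eq, edist_dist, Real.dist_eq, sub_zero, abs_of_nonneg (reflectedWalk_nonneg n)]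
  exact ENNReal.one_le_ofReal.2 (le_of_lt hω)

/-- Time reversal: `R n` has the law of `- min (S 0, …, S n)`. -/
theorem measure_lt_reflectedWalk_eq (hmeas : ∀ i, Measurable (X i)) (hindep : iIndepFun X P)
    (hident : ∀ i, IdentDistrib (X i) (X 0) P P) (n : ℕ) (x : ℝ) :
    P {ω | x < reflectedWalk X n ω} = P {ω | ∃ j ≤ n, randomWalk X j ω < -x} := by
  have := hindep.isProbabilityMeasure
  -- Reverses the first `n` indices and fixes the others, so that it is injective on all of `ℕ`.
  set σ : ℕ → ℕ := fun i => if i < n then n - 1 - i else i with hσ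
  have hinj : σ.Injective := fun i j hij => by
    simp only [hσ] at hij
    split_ifs at hij <;> omega
  have hrev : ∀ ω, ∀ j ≤ n, randomWalk (fun i => X (σ i)) j ω =
      randomWalk X n ω - randomWalk X (n - j) ω := fun ω j hj => by
    induction j with
    | zero => simp [randomWalk]
    | succ j ih =>
      have h1 : n - j = n - (j + 1) + 1 := by omega
      have h2 : σ j = n - (j + 1) := by simp only [hσ]; split_ifs <;> omega
      rw [randomWalk_succ, ih (by omega), h1, randomWalk_succ, h2]
      ring
  have hB : MeasurableSet {y : ℕ → ℝ | ∃ j ≤ n, randomWalk (fun i (y : ℕ → ℝ) => y i) j y < -x} := by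
    have : ∀ j, Measurable (randomWalk (fun i (y : ℕ → ℝ) => y i) j) := fun j =>
      measurable_randomWalk fun i _ => measurable_pi_apply i
    simp only [Set.ofPred_exists, Set.ofPred_and]
    exact MeasurableSet.iUnion fun j =>
      (MeasurableSet.const _).inter (measurableSet_lt (this j) measurable_const)
  refine Eq.trans ?_ (measure_comp_injective hmeas hindep hident hinj hB)
  congr 1
  ext ω
  rw [Set.mem_ofPred_eq, lt_reflectedWalk_iff]
  change _ ↔ ∃ j ≤ n, randomWalk (fun i => X (σ i)) j ω < -x
  constructor
  · rintro ⟨j, hj, h⟩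
    refine ⟨n - j, by omega, ?_⟩
    rw [hrev ω _ (by omega), Nat.sub_sub_self hj]
    linarith
  · rintro ⟨j, hj, h⟩
    refine ⟨n - j, by omega, ?_⟩
    rw [hrev ω _ hj] at h
    linarith

theorem tendsto_measure_lt_reflectedWalk (hmeas : ∀ i, Measurable (X i)) (hindep : iIndepFun X P)
    (hident : ∀ i, IdentDistrib (X i) (X 0) P P) (x : ℝ) :
    Tendsto (fun n => P {ω | x < reflectedWalk X n ω}) atTop
      (𝓝 (P {ω | ∃ j, randomWalk X j ω < -x})) := by
  simp only [measure_lt_reflectedWalk_eq hmeas hindep hident]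
  have hU : {ω | ∃ j, randomWalk X j ω < -x} = ⋃ n, {ω | ∃ j ≤ n, randomWalk X j ω < -x} := by
    ext ω
    simp only [Set.mem_ofPred_eq, Set.mem_iUnion]
    exact ⟨fun ⟨j, h⟩ => ⟨j, j, le_rfl, h⟩, fun ⟨_, j, _, h⟩ => ⟨j, h⟩⟩
  rw [hU]
  exact tendsto_measure_iUnion_atTop fun n m hnm ω ⟨j, hj, h⟩ => ⟨j, hj.trans hnm, h⟩

theorem tendstoInProbabilityAtTop_reflectedWalk_iff (hmeas : ∀ i, Measurable (X i))
    (hindep : iIndepFun X P) (hident : ∀ i, IdentDistrib (X i) (X 0) P P) :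
    TendstoInProbabilityAtTop P (reflectedWalk X) ↔
      ∀ᵐ ω ∂P, liminf (fun n => (randomWalk X n ω : EReal)) atTop = ⊥ := by
  have := hindep.isProbabilityMeasure
  have hm : ∀ x : ℝ, MeasurableSet {ω | ∃ j, randomWalk X j ω < x} := fun x => by
    simp only [Set.ofPred_exists]
    exact MeasurableSet.iUnion fun j =>
      measurableSet_lt (measurable_randomWalk fun i _ => hmeas i) measurable_const
  have h1 : TendstoInProbabilityAtTop P (reflectedWalk X) ↔
      ∀ x : ℝ, ∀ᵐ ω ∂P, ∃ j, randomWalk X j ω < -x := by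
    refine forall_congr' fun x => ?_
    refine Iff.trans ?_ (mem_ae_iff_prob_eq_one (hm (-x))).symm
    have ht := tendsto_measure_lt_reflectedWalk hmeas hindep hident x
    exact ⟨fun h => tendsto_nhds_unique ht h, fun h => h ▸ ht⟩
  simp only [h1, liminf_randomWalk_eq_bot_iff]
  constructor
  · intro h
    filter_upwards [ae_all_iff.2 fun n : ℕ => h n] with ω hω x
    obtain ⟨n, hn⟩ := exists_nat_gt (-x)
    obtain ⟨j, hj⟩ := hω n
    exact ⟨j, by linarith⟩
  · exact fun h x => h.mono fun ω hω => hω (-x)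

/-- The renewal identity for the last zero of the reflected walk. -/
theorem measure_last_zero_eq (hmeas : ∀ i, Measurable (X i)) (hindep : iIndepFun X P)
    (hident : ∀ i, IdentDistrib (X i) (X 0) P P) (n : ℕ) :
    P {ω | reflectedWalk X n ω = 0 ∧ ∀ m, 0 < m → randomWalk X (n + m) ω < randomWalk X n ω} =
      P {ω | reflectedWalk X n ω = 0} * P {ω | ∀ m, 0 < m → randomWalk X m ω < 0} := by
  have := hindep.isProbabilityMeasure
  have hshift : ∀ m ω, randomWalk (fun i => X (n + i)) m ω =
      randomWalk X (n + m) ω - randomWalk X n ω := fun m ω => by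
    rw [randomWalk, randomWalk, Finset.sum_range_add, randomWalk, add_sub_cancel_left]
  have hlaw := measure_comp_injective hmeas hindep hident (add_right_injective n)
    (measurableSet_forall_randomWalk_neg (X := fun i (y : ℕ → ℝ) => y i) measurable_pi_apply)
  change P {ω | ∀ m, 0 < m → randomWalk (fun i => X (n + i)) m ω < 0} =
    P {ω | ∀ m, 0 < m → randomWalk X m ω < 0} at hlaw
  rw [← hlaw, ← measure_inter_past_future hmeas hindep (n := n)
    (A := {ω | reflectedWalk X n ω = 0})
    (fun m hm => measurable_reflectedWalk hm (measurableSet_singleton 0))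
    (fun m hm => measurableSet_forall_randomWalk_neg fun i => hm _ (Nat.le_add_right n i))]
  congr 1
  ext ω
  simp [hshift]

theorem tsum_measure_reflectedWalk_eq_zero_lt_top (hmeas : ∀ i, Measurable (X i))
    (hindep : iIndepFun X P) (hident : ∀ i, IdentDistrib (X i) (X 0) P P)
    (h : P {ω | ∃ᶠ n in atTop, reflectedWalk X n ω = 0} < 1) :
    ∑' n, P {ω | reflectedWalk X n ω = 0} < ⊤ := by
  have := hindep.isProbabilityMeasure
  set E : ℕ → Set Ω := fun n =>
    {ω | reflectedWalk X n ω = 0 ∧ ∀ m, 0 < m → randomWalk X (n + m) ω < randomWalk X n ω} with hE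
  set v := P {ω | ∀ m, 0 < m → randomWalk X m ω < 0}
  have hR : ∀ n, Measurable (reflectedWalk X n) := fun n =>
    measurable_reflectedWalk fun i _ => hmeas i
  have hS : ∀ n, Measurable (randomWalk X n) := fun n =>
    measurable_randomWalk fun i _ => hmeas i
  have hEm : ∀ n, MeasurableSet (E n) := fun n => by
    refine (hR n (measurableSet_singleton 0)).inter
      (?_ : MeasurableSet {ω | ∀ m, 0 < m → randomWalk X (n + m) ω < randomWalk X n ω})
    simp only [Set.ofPred_forall]
    exact MeasurableSet.iInter fun m => MeasurableSet.iInter fun _ =>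
      measurableSet_lt (hS _) (hS _)
  have hdisj : Pairwise (Function.onFun Disjoint E) := by
    intro n m hnm
    wlog hlt : n < m generalizing n m
    · exact (this hnm.symm (by omega)).symm
    -- The walk is strictly below `S n` at time `m`, yet a zero of `R` at `m` makes `S m` the
    -- maximum so far.
    refine Set.disjoint_left.2 fun ω hn hm => ?_
    have h1 := hn.2 (m - n) (by omega)
    rw [Nat.add_sub_cancel' hlt.le] at h1
    have h2 := sub_le_reflectedWalk (X := X) (ω := ω) hlt.le
    rw [hm.1] at h2
    linarith
  have hsum : (∑' n, P {ω | reflectedWalk X n ω = 0}) * v = P (⋃ n, E n) := by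
    rw [measure_iUnion hdisj hEm, ← ENNReal.tsum_mul_right]
    exact tsum_congr fun n => (measure_last_zero_eq hmeas hindep hident n).symm
  have hne : P (⋃ n, E n) ≠ 0 := fun h0 => by
    refine h.ne (le_antisymm prob_le_one ?_)
    have hae : ∀ᵐ ω ∂P, ∃ᶠ n in atTop, reflectedWalk X n ω = 0 :=
      measure_mono_null (fun ω hω => Set.mem_iUnion.2 (exists_last_zero hω)) h0
    exact measure_univ (μ := P) ▸ measure_mono_ae (hae.mono fun ω hω _ => hω)
  have hv : v ≠ 0 := fun hv => hne (by rw [← hsum, hv, mul_zero])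
  refine lt_top_iff_ne_top.2 fun htop => ?_
  rw [htop, ENNReal.top_mul hv] at hsum
  exact (measure_ne_top P _) hsum.symm

/-- From a level at most `x`, the next `k` steps all exceed `δ` with a fixed positive probability,
independently of the past; as `k * δ > x`, they bring `R` to zero. -/
theorem tsum_measure_reflectedWalk_le_lt_top (hmeas : ∀ i, Measurable (X i))
    (hindep : iIndepFun X P) (hident : ∀ i, IdentDistrib (X i) (X 0) P P)
    (hpos : 0 < P {ω | 0 < X 0 ω}) (h : ∑' n, P {ω | reflectedWalk X n ω = 0} < ⊤) (x : ℝ) :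
    ∑' n, P {ω | reflectedWalk X (n + 1) ω ≤ x} < ⊤ := by
  have := hindep.isProbabilityMeasure
  obtain ⟨δ, hδ, hP⟩ := exists_pos_measure_lt_neg (P := P) (Y := fun ω => -X 0 ω)
    (by simpa using hpos)
  simp only [neg_lt_neg_iff] at hP
  obtain ⟨k, hk⟩ := exists_nat_gt (x / δ)
  have hk' := (div_lt_iff₀ hδ).1 hk
  have key : ∀ n, P {ω | reflectedWalk X n ω ≤ x} * P {ω | δ < X 0 ω} ^ k ≤
      P {ω | reflectedWalk X (n + k) ω = 0} := fun n => by
    have hb := measure_forall_mem_finset hindep hident (measurableSet_Ioi (a := δ))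
      (Finset.Ico n (n + k))
    rw [Nat.card_Ico, Nat.add_sub_cancel_left] at hb
    simp only [Set.mem_Ioi] at hb
    rw [← hb, ← measure_inter_past_future hmeas hindep (n := n)
      (A := {ω | reflectedWalk X n ω ≤ x}) (B := {ω | ∀ i ∈ Finset.Ico n (n + k), δ < X i ω})
      (fun m hm => measurable_reflectedWalk hm measurableSet_Iic)
      (fun m hm => measurableSet_forall_mem_finset
        (fun i hi => hm i (Finset.mem_Ico.1 hi).1) measurableSet_Ioi)]
    refine measure_mono fun ω ⟨h1, h2⟩ => le_antisymm ?_ (reflectedWalk_nonneg _)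
    refine (reflectedWalk_add_le hδ.le (mem_block_iff.1 h2)).trans (max_le ?_ le_rfl)
    have h1' : reflectedWalk X n ω ≤ x := h1
    linarith
  have hsum : (∑' n, P {ω | reflectedWalk X (n + 1) ω ≤ x}) * P {ω | δ < X 0 ω} ^ k < ⊤ := by
    rw [← ENNReal.tsum_mul_right]
    refine (ENNReal.tsum_le_tsum fun n => key (n + 1)).trans_lt (lt_of_le_of_lt ?_ h)
    exact ENNReal.tsum_comp_le_tsum_of_injective
      (f := fun n => n + 1 + k) (fun a b hab => by simpa using hab) _
  refine lt_top_iff_ne_top.2 fun htop => ?_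
  rw [htop, ENNReal.top_mul (ENNReal.pow_pos hP k).ne'] at hsum
  exact lt_irrefl _ hsum

theorem ae_eventually_lt_reflectedWalk {x : ℝ}
    (h : ∑' n, P {ω | reflectedWalk X (n + 1) ω ≤ x} < ⊤) :
    ∀ᵐ ω ∂P, ∀ᶠ n in atTop, x < reflectedWalk X n ω := by
  filter_upwards [ae_eventually_notMem h.ne] with ω hω
  -- The series starts at time 1, hence the shift.
  rw [← map_add_atTop_eq_nat 1, eventually_map]
  exact hω.mono fun n hn => not_le.1 hn

end IID

theorem proposition1p1 {Ω : Type*} [MeasurableSpace Ω] (P : Measure Ω) [IsProbabilityMeasure P]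
    (X : ℕ → Ω → ℝ)
    (hmeas : ∀ i, Measurable (X i))
    (hindep : iIndepFun X P)
    (hident : ∀ i, IdentDistrib (X i) (X 0) P P)
    (hneg : 0 < P {ω | X 0 ω < 0})
    (hpos : P {ω | X 0 ω ≤ 0} < 1) :
    -- (a)
    ((∀ x : ℝ, 0 < x → 0 < liminf (fun n => P {ω | x < reflectedWalk X n ω}) atTop) ∧
      (∀ᵐ ω ∂P, limsup (fun n => (reflectedWalk X n ω : EReal)) atTop = ⊤) ∧
      ¬ TendstoInMeasure P (reflectedWalk X) atTop (fun _ => (0 : ℝ))) ∧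
    -- (b)(i)
    (TendstoInProbabilityAtTop P (reflectedWalk X) ↔
      ∀ᵐ ω ∂P, liminf (fun n => (randomWalk X n ω : EReal)) atTop = ⊥) ∧
    -- (b)(ii)
    List.TFAE [
      P {ω | ∃ᶠ n in atTop, reflectedWalk X n ω = 0} < 1,
      ∀ᵐ ω ∂P, Tendsto (fun n => randomWalk X n ω) atTop atBot,
      ∀ᵐ ω ∂P, Tendsto (fun n => reflectedWalk X n ω) atTop atTop,
      ∃ x : ℝ, 0 ≤ x ∧ ∑' n : ℕ, P {ω | reflectedWalk X (n + 1) ω ≤ x} < ⊤,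
      ∀ x : ℝ, 0 ≤ x → ∑' n : ℕ, P {ω | reflectedWalk X (n + 1) ω ≤ x} < ⊤] := by
  have hpos' : 0 < P {ω | 0 < X 0 ω} := by
    have hm : MeasurableSet {ω | X 0 ω ≤ 0} := measurableSet_le (hmeas 0) measurable_const
    have hc := prob_compl_eq_one_sub (μ := P) hm
    have hset : {ω | X 0 ω ≤ 0}ᶜ = {ω | 0 < X 0 ω} := by ext; simp
    rw [← hset, hc]
    exact tsub_pos_of_lt hpos
  have hzero : (∀ᵐ ω ∂P, ∀ᶠ n in atTop, 0 < reflectedWalk X n ω) →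
      P {ω | ∃ᶠ n in atTop, reflectedWalk X n ω = 0} < 1 := fun h => by
    -- The probability is in fact zero.
    refine lt_of_le_of_lt (le_of_eq ?_) zero_lt_one
    refine measure_mono_null (fun ω (hω : ∃ᶠ n in atTop, _) => ?_) h
    exact not_eventually.2 (hω.mono fun n hn => hn.not_gt)
  refine ⟨⟨fun x _ => liminf_measure_lt_reflectedWalk_pos hindep hident hneg x,
    ae_limsup_reflectedWalk_eq_top hmeas hindep hident hneg,
    not_tendstoInMeasure_reflectedWalk hindep hident hneg⟩,
    tendstoInProbabilityAtTop_reflectedWalk_iff hmeas hindep hident, ?_⟩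
  tfae_have 1 → 5 := fun h x _ => tsum_measure_reflectedWalk_le_lt_top hmeas hindep hident hpos'
    (tsum_measure_reflectedWalk_eq_zero_lt_top hmeas hindep hident h) x
  tfae_have 5 → 4 := fun h => ⟨0, le_rfl, h 0 le_rfl⟩
  tfae_have 4 → 1 := fun ⟨x, hx, h⟩ => hzero <|
    (ae_eventually_lt_reflectedWalk h).mono fun ω hω => hω.mono fun n hn => hx.trans_lt hn
  tfae_have 5 → 3 := fun h => by
    filter_upwards [ae_all_iff.2 fun k : ℕ =>
      ae_eventually_lt_reflectedWalk (h k (Nat.cast_nonneg k))] with ω hω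
    refine tendsto_atTop.2 fun x => ?_
    obtain ⟨k, hk⟩ := exists_nat_gt x
    exact (hω k).mono fun n hn => (hk.trans hn).le
  tfae_have 3 → 1 := fun h => hzero <| h.mono fun ω hω => hω.eventually_gt_atTop 0
  tfae_have 3 → 2 := fun h => h.mono fun ω => tendsto_randomWalk_atBot_of_reflectedWalk
  tfae_have 2 → 3 := fun h => h.mono fun ω => tendsto_reflectedWalk_atTop_of_randomWalk
  tfae_finish
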